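/- Let $n\ge 1$ and let $H^2(\mathbb D^n)$ be the Hardy space of the unit polydisc, i.e. the Hilbert space of all functions $f(z)=\sum_{k\in\mathbb N^n}a_kz^k$ on $\mathbb D^n$ with $\|f\|^2=\sum_k|a_k|^2<\infty$. A bounded operator $T$ on a Hilbert space $\mathcal H$ is called a pure contraction if $\|T\|\le 1$ and $\|T^{*m}h\|\to 0$ as $m\to\infty$ for every $h\in\mathcal H$. A multiplier of $H^2(\mathbb D^n)$ is a function $\phi:\mathbb D^n\to\mathbb C$ with $\phi f\in H^2(\mathbb D^n)$ for all $f\in H^2(\mathbb D^n)$; then $M_\phi f=\phi f$ is a bounded operator on $H^2(\mathbb D^n)$, and $\phi$ is called contractive if $\|M_\phi\|\le 1$. An inner function is a bounded holomorphic function $\theta$ on $\mathbb D^n$ whose radial limits exist and have modulus one at almost every point of the torus $\mathbb T^n$. A closed subspace $\mathcal S$ of $H^2(\mathbb D^n)$ is called jointly $M_z$-invariant if $M_{z_i}\mathcal S\subseteq\mathcal S$ for $i=1,\dots,n$; it is then called doubly commuting if the restrictions $R_i=M_{z_i}|_{\mathcal S}\in\mathcal B(\mathcal S)$ satisfy $R_i^*R_j=R_jR_i^*$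 for all $i\ne j$. A doubly commuting jointly $M_z$-invariant closed subspace $\mathcal S$ is called non-zero based if $\mathcal S=\theta H^2(\mathbb D^n)$ for some inner function $\theta$ with $\theta(0)\neq 0$. Let $\phi\in H^\infty(\mathbb D^n)$ (a bounded holomorphic function on $\mathbb D^n$) be a contractive multiplier of $H^2(\mathbb D^n)$. Then $M_\phi$ is a pure contraction on $H^2(\mathbb D^n)$ if and only if there exists a non-zero based doubly commuting jointly $M_z$-invariant closed subspace $\mathcal S$ of $H^2(\mathbb D^n)$ such that $M_\phi|_{\mathcal S}:\mathcal S\to\mathcal S$ is a pure contraction. -/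

import Mathlib

open Filter Topology MeasureTheory
open scoped ComplexConjugate InnerProductSpace

/-- The open unit polydisc `𝔻ⁿ` in `ℂⁿ`. -/
def polydisc (n : ℕ) : Set (Fin n → ℂ) := {z | ∀ i, ‖z i‖ < 1}

/-! ### The Hardy space of the polydisc -/

/-- The Hardy space `H²(𝔻ⁿ)`: power series `∑ₖ aₖ zᵏ` (`k` a multi-index) with square summable
coefficients, with the norm `(∑ₖ |aₖ|²)^(1/2)`. An element is stored as its coefficient family;
the function on the polydisc that it represents is given by the `RKHS` instance below, so that
`f z` is the value of `f : Hardy n` at `z : polydisc n`. -/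
def Hardy (n : ℕ) : Type := lp (fun _ : Fin n → ℕ => ℂ) 2

namespace Hardy

noncomputable instance (n : ℕ) : NormedAddCommGroup (Hardy n) :=
  inferInstanceAs (NormedAddCommGroup (lp (fun _ : Fin n → ℕ => ℂ) 2))

noncomputable instance (n : ℕ) : InnerProductSpace ℂ (Hardy n) :=
  inferInstanceAs (InnerProductSpace ℂ (lp (fun _ : Fin n → ℕ => ℂ) 2))

instance (n : ℕ) : CompleteSpace (Hardy n) :=
  inferInstanceAs (CompleteSpace (lp (fun _ : Fin n → ℕ => ℂ) 2))

/-- The coefficient of `zᵏ`. -/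
def coeff {n : ℕ} (f : Hardy n) (k : Fin n → ℕ) : ℂ := (f : lp (fun _ : Fin n → ℕ => ℂ) 2).1 k

/-- The element of the Hardy space with a given square summable coefficient family. -/
def ofCoeff {n : ℕ} (a : (Fin n → ℕ) → ℂ) (ha : Memℓp a 2) : Hardy n :=
  (⟨a, ha⟩ : lp (fun _ : Fin n → ℕ => ℂ) 2)

theorem coeff_ofCoeff {n : ℕ} (a : (Fin n → ℕ) → ℂ) (ha : Memℓp a 2) :
    (ofCoeff a ha).coeff = a := rfl

theorem ext_coeff {n : ℕ} {f g : Hardy n} (h : f.coeff = g.coeff) : f = g :=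
  Subtype.ext h

theorem coeff_memℓp {n : ℕ} (f : Hardy n) : Memℓp f.coeff 2 :=
  lp.memℓp (f : lp (fun _ : Fin n → ℕ => ℂ) 2)

theorem hasSum_inner {n : ℕ} (f g : Hardy n) :
    HasSum (fun k => conj (f.coeff k) * g.coeff k) ⟪f, g⟫_ℂ := by
  have h := lp.hasSum_inner (𝕜 := ℂ) (f : lp (fun _ : Fin n → ℕ => ℂ) 2) g
  simp only [RCLike.inner_apply'] at h
  exact h

theorem summable_prod_pow {n : ℕ} (r : Fin n → ℝ) (h0 : ∀ i, 0 ≤ r i) (h1 : ∀ i, r i < 1) :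
    Summable fun k : Fin n → ℕ => ∏ i, r i ^ k i := by
  induction n with
  | zero => exact (hasSum_fintype _).summable
  | succ n ih =>
    rw [← (Fin.consEquiv (fun _ : Fin (n + 1) => ℕ)).summable_iff]
    have h := (summable_geometric_of_lt_one (h0 0) (h1 0)).mul_of_nonneg
      (ih (fun i => r i.succ) (fun i => h0 _) (fun i => h1 _))
      (fun k => pow_nonneg (h0 0) k)
      (fun k => Finset.prod_nonneg fun i _ => pow_nonneg (h0 _) _)
    refine h.congr fun k => ?_
    simp [Fin.consEquiv, Fin.prod_univ_succ]

/-- The Szegő kernel function at `z`, with coefficients `conj (zᵏ)`. -/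
noncomputable def szego {n : ℕ} (z : polydisc n) : Hardy n :=
  ofCoeff (fun k => ∏ i, conj (z.1 i) ^ k i) <| by
    refine memℓp_gen ?_
    refine (summable_prod_pow (fun i => ‖z.1 i‖ ^ 2) (fun i => by positivity)
      (fun i => pow_lt_one₀ (norm_nonneg _) (z.2 i) two_ne_zero)).congr fun k => ?_
    simp only [norm_prod, norm_pow, RCLike.norm_conj, ENNReal.toReal_ofNat, Real.rpow_ofNat,
      ← Finset.prod_pow]
    exact Finset.prod_congr rfl fun i _ => by rw [← pow_mul, ← pow_mul, mul_comm]

theorem hasSum_eval {n : ℕ} (f : Hardy n) (z : polydisc n) :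
    HasSum (fun k => f.coeff k * ∏ i, z.1 i ^ k i) ⟪szego z, f⟫_ℂ := by
  refine (hasSum_inner (szego z) f).congr_fun ?_
  intro k
  simp [szego, coeff_ofCoeff, mul_comm]

theorem coeff_eq_zero_of_one_var (b : ℕ → ℂ)
    (h : ∀ w : ℂ, ‖w‖ < 1 → HasSum (fun j => b j * w ^ j) 0) : b = 0 := by
  have hp : HasFPowerSeriesOnBall (fun _ : ℂ => (0 : ℂ)) (FormalMultilinearSeries.ofScalars ℂ b)
      0 ((1 / 2 : NNReal) : ENNReal) := by
    refine ⟨?_, by norm_num, ?_⟩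
    · refine FormalMultilinearSeries.le_radius_of_summable_norm _ ?_
      have h2 := (h (1 / 2) (by norm_num)).summable.norm
      refine Summable.of_nonneg_of_le (fun _ => by positivity) (fun j => ?_) h2
      rw [FormalMultilinearSeries.ofScalars_norm]
      simp
    · intro y hy
      have hy' : ‖y‖ < 1 := by
        have : ‖y‖ < 1 / 2 := by
          have h1 : ‖y‖₊ < 1 / 2 := by
            rw [Metric.mem_eball, edist_zero_right] at hy
            exact_mod_cast hy
          exact_mod_cast h1
        linarith
      simpa [FormalMultilinearSeries.ofScalars_apply_eq, mul_comm] using h y hy'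
  have h0 := hp.hasFPowerSeriesAt.eq_zero
  exact (FormalMultilinearSeries.ofScalars_series_eq_zero (E := ℂ) (c := b)).1 h0

theorem coeff_eq_zero_of_eval {n : ℕ} (a : (Fin n → ℕ) → ℂ)
    (h : ∀ z : Fin n → ℂ, (∀ i, ‖z i‖ < 1) → HasSum (fun k => a k * ∏ i, z i ^ k i) 0) :
    a = 0 := by
  induction n with
  | zero =>
    funext k
    have h1 := (h 0 (fun i => i.elim0)).unique (hasSum_unique _)
    simp only [Finset.univ_eq_empty, Finset.prod_empty, mul_one] at h1
    exact (congrArg a (Subsingleton.elim _ _)).trans h1.symm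
  | succ n ih =>
    have key : ∀ j : ℕ, (fun k' : Fin n → ℕ => a (Fin.cons j k')) = 0 := by
      intro j
      refine ih _ fun z' hz' => ?_
      have hs : ∀ w : ℂ, ‖w‖ < 1 → HasSum (fun p : ℕ × (Fin n → ℕ) =>
          a (Fin.cons p.1 p.2) * (w ^ p.1 * ∏ i, z' i ^ p.2 i)) 0 := by
        intro w hw
        have h1 := h (Fin.cons w z') (fun i => by
          refine Fin.cases ?_ (fun i => ?_) i
          · simpa using hw
          · simpa using hz' i)
        rw [← (Fin.consEquiv (fun _ : Fin (n + 1) => ℕ)).hasSum_iff] at h1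
        refine h1.congr_fun fun p => ?_
        simp [Fin.consEquiv, Fin.prod_univ_succ]
      have hin : ∀ j, Summable fun k' : Fin n → ℕ => a (Fin.cons j k') * ∏ i, z' i ^ k' i := by
        intro j
        have h1 := (hs (1 / 2) (by norm_num)).summable.prod_factor j
        have h2 := h1.mul_left (((1 / 2 : ℂ) ^ j)⁻¹)
        refine h2.congr fun k' => ?_
        have : ((1 / 2 : ℂ) ^ j) ≠ 0 := pow_ne_zero _ (by norm_num)
        field_simp
      have hb := coeff_eq_zero_of_one_var
        (fun j => ∑' k' : Fin n → ℕ, a (Fin.cons j k') * ∏ i, z' i ^ k' i) (fun w hw => by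
          refine (hs w hw).prod_fiberwise fun j => ?_
          refine ((hin j).hasSum.mul_right (w ^ j)).congr_fun fun k' => ?_
          ring)
      have h3 := (hin j).hasSum
      rwa [show (∑' k' : Fin n → ℕ, a (Fin.cons j k') * ∏ i, z' i ^ k' i) = 0 from
        congrFun hb j] at h3
    funext k
    have := congrFun (key (k 0)) (Fin.tail k)
    simpa using this

/-- The Hardy space as a reproducing kernel Hilbert space of functions on the polydisc: the value
of `f` at `z` is the sum of its power series. -/
noncomputable instance (n : ℕ) : RKHS ℂ (Hardy n) (polydisc n) ℂ where
  coeCLM :=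
    { toFun := fun f z => ∑' k, f.coeff k * ∏ i, z.1 i ^ k i
      map_add' := fun f g => by
        funext z
        simp only [(hasSum_eval _ z).tsum_eq, inner_add_right, Pi.add_apply]
      map_smul' := fun c f => by
        funext z
        simp only [(hasSum_eval _ z).tsum_eq, inner_smul_right, Pi.smul_apply, RingHom.id_apply,
          smul_eq_mul]
      cont := by
        refine continuous_pi fun z => ?_
        simp only [(hasSum_eval _ z).tsum_eq]
        fun_prop }
  coeCLM_injective := by
    refine (injective_iff_map_eq_zero _).2 fun f hf => ext_coeff ?_
    refine coeff_eq_zero_of_eval _ fun z hz => ?_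
    have h1 := hasSum_eval f ⟨z, hz⟩
    have h2 : (∑' k, f.coeff k * ∏ i, z i ^ k i) = 0 := congrFun hf ⟨z, hz⟩
    rw [← h1.tsum_eq] at h1
    rwa [h2] at h1

theorem apply_eq_tsum {n : ℕ} (f : Hardy n) (z : polydisc n) :
    f z = ∑' k, f.coeff k * ∏ i, z.1 i ^ k i := rfl

theorem hasSum_apply {n : ℕ} (f : Hardy n) (z : polydisc n) :
    HasSum (fun k => f.coeff k * ∏ i, z.1 i ^ k i) (f z) := by
  rw [apply_eq_tsum, (hasSum_eval f z).tsum_eq]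
  exact hasSum_eval f z

theorem inner_szego {n : ℕ} (z : polydisc n) (f : Hardy n) : ⟪szego z, f⟫_ℂ = f z := by
  rw [apply_eq_tsum, (hasSum_eval f z).tsum_eq]

end Hardy

/-! ### Multipliers and multiplication operators -/

/-- `φ` is a multiplier of `H²(𝔻ⁿ)`: `φ f` belongs to `H²(𝔻ⁿ)` for all `f` in `H²(𝔻ⁿ)`. -/
def IsMultiplier {n : ℕ} (φ : (Fin n → ℂ) → ℂ) : Prop :=
  ∀ f : Hardy n, ∃ g : Hardy n, ∀ z : polydisc n, g z = φ z * f z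

/-- The multiplication operator `M_φ` on `H²(𝔻ⁿ)`; it is bounded by the closed graph theorem. -/
noncomputable def mulOp {n : ℕ} (φ : (Fin n → ℂ) → ℂ) (hφ : IsMultiplier φ) :
    Hardy n →L[ℂ] Hardy n :=
  ContinuousLinearMap.ofSeqClosedGraph
    (g := { toFun := fun f => (hφ f).choose
            map_add' := fun f g => by
              refine RKHS.ext fun z => ?_
              refine ((hφ (f + g)).choose_spec z).trans ?_
              simp only [RKHS.coe_add, Pi.add_apply]
              rw [(hφ f).choose_spec z, (hφ g).choose_spec z, mul_add]
            map_smul' := fun c f => by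
              refine RKHS.ext fun z => ?_
              refine ((hφ (c • f)).choose_spec z).trans ?_
              simp only [RKHS.coe_smul, Pi.smul_apply, RingHom.id_apply, smul_eq_mul]
              rw [(hφ f).choose_spec z, mul_left_comm] }) <| by
    intro u f g hu hg
    refine RKHS.ext fun z => ?_
    have h1 := ((RKHS.continuous_eval (𝕜 := ℂ) (H := Hardy n) z).tendsto g).comp hg
    have h2 := (((RKHS.continuous_eval (𝕜 := ℂ) (H := Hardy n) z).tendsto f).comp hu).const_mul
      (φ z)
    refine tendsto_nhds_unique h1 ?_
    change Tendsto _ _ (𝓝 ((hφ f).choose z))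
    rw [(hφ f).choose_spec z]
    refine h2.congr fun m => ?_
    exact ((hφ (u m)).choose_spec z).symm

theorem mulOp_apply {n : ℕ} (φ : (Fin n → ℂ) → ℂ) (hφ : IsMultiplier φ) (f : Hardy n)
    (z : polydisc n) : mulOp φ hφ f z = φ z * f z :=
  (hφ f).choose_spec z

/-- The coordinate functions are multipliers. -/
theorem isMultiplier_coord {n : ℕ} (i : Fin n) : IsMultiplier fun z : Fin n → ℂ => z i := by
  intro f
  let s : (Fin n → ℕ) → (Fin n → ℕ) := fun k => k + Pi.single i 1
  have hs : Function.Injective s := add_left_injective _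
  have hmem : Memℓp (Function.extend s f.coeff 0) 2 := by
    refine memℓp_gen ?_
    have h1 := (f.coeff_memℓp).summable (by norm_num)
    rw [← summable_extend_zero hs] at h1
    refine h1.congr fun k => ?_
    by_cases hk : ∃ j, s j = k
    · obtain ⟨j, rfl⟩ := hk
      simp [hs.extend_apply]
    · simp [Function.extend_apply' _ _ _ hk]
  refine ⟨Hardy.ofCoeff _ hmem, fun z => ?_⟩
  refine (Hardy.hasSum_apply _ z).unique ?_
  have h1 := (Hardy.hasSum_apply f z).mul_left (z.1 i)
  rw [← hasSum_extend_zero hs] at h1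
  refine h1.congr_fun fun k => ?_
  rw [Hardy.coeff_ofCoeff]
  by_cases hk : ∃ j, s j = k
  · obtain ⟨j, rfl⟩ := hk
    have : ∏ l, z.1 l ^ s j l = (∏ l, z.1 l ^ j l) * z.1 i := by
      simp only [s, Pi.add_apply, pow_add, Finset.prod_mul_distrib]
      congr 1
      rw [Finset.prod_eq_single i] <;> simp +contextual
    rw [hs.extend_apply, hs.extend_apply, this]
    ring
  · simp [Function.extend_apply' _ _ _ hk]

/-- The coordinate shift `M_{z_i}` on `H²(𝔻ⁿ)`. -/
noncomputable def coordShift {n : ℕ} (i : Fin n) : Hardy n →L[ℂ] Hardy n :=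
  mulOp (fun z => z i) (isMultiplier_coord i)

/-! ### Bounded holomorphic functions and inner functions -/

/-- `φ ∈ H^∞(𝔻ⁿ)`: `φ` is holomorphic and bounded on the polydisc. (As everywhere below, the
values of `φ` outside the polydisc play no role.) -/
def IsHInfty {n : ℕ} (φ : (Fin n → ℂ) → ℂ) : Prop :=
  DifferentiableOn ℂ φ (polydisc n) ∧ ∃ C : ℝ, ∀ z ∈ polydisc n, ‖φ z‖ ≤ C

/-- `θ` is an inner function: `θ ∈ H^∞(𝔻ⁿ)`, and for almost every point
`ζ = (e^{2πi t_1}, …, e^{2πi t_n})` of the torus the radial limit of `θ` at `ζ` exists and has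
modulus one. -/
def IsInner {n : ℕ} (θ : (Fin n → ℂ) → ℂ) : Prop :=
  IsHInfty θ ∧ ∀ᵐ t : UnitAddTorus (Fin n), ∃ w : ℂ, ‖w‖ = 1 ∧
    Tendsto (fun r : ℝ => θ fun i => (r : ℂ) * (AddCircle.toCircle (t i) : ℂ)) (𝓝[<] 1) (𝓝 w)

/-! ### Pure contractions and doubly commuting subspaces -/

/-- `T` is a pure contraction: `‖T‖ ≤ 1` and `T*ᵐ → 0` in the strong operator topology. -/
def IsPureContraction {H : Type*} [NormedAddCommGroup H] [InnerProductSpace ℂ H]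
    [CompleteSpace H] (T : H →L[ℂ] H) : Prop :=
  ‖T‖ ≤ 1 ∧ ∀ h : H, Tendsto (fun m : ℕ => ‖(ContinuousLinearMap.adjoint T ^ m) h‖) atTop (𝓝 0)

/-- A doubly commuting tuple of operators: `X_i X_j = X_j X_i` for all `i, j`, and
`X_i* X_j = X_j X_i*` for `i ≠ j`. -/
def IsDoublyCommuting {n : ℕ} {H : Type*} [NormedAddCommGroup H] [InnerProductSpace ℂ H]
    [CompleteSpace H] (X : Fin n → H →L[ℂ] H) : Prop :=
  (∀ i j, X i * X j = X j * X i) ∧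
    ∀ i j, i ≠ j →
      ContinuousLinearMap.adjoint (X i) * X j = X j * ContinuousLinearMap.adjoint (X i)

/-- The restriction `T|_S : S → S` of an operator to a closed invariant subspace. -/
noncomputable def restrictOp {H : Type*} [NormedAddCommGroup H] [InnerProductSpace ℂ H]
    (T : H →L[ℂ] H) (S : ClosedSubmodule ℂ H) (h : ∀ f ∈ S.toSubmodule, T f ∈ S.toSubmodule) :
    S.toSubmodule →L[ℂ] S.toSubmodule :=
  T.restrict h

instance {H : Type*} [NormedAddCommGroup H] [InnerProductSpace ℂ H] [CompleteSpace H]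
    (S : ClosedSubmodule ℂ H) : CompleteSpace S.toSubmodule :=
  S.isClosed'.completeSpace_coe

/-- The closed subspace `S` of `H²(𝔻ⁿ)` is jointly invariant under the coordinate shifts. -/
def IsShiftInvariant {n : ℕ} (S : ClosedSubmodule ℂ (Hardy n)) : Prop :=
  ∀ i, ∀ f ∈ S.toSubmodule, coordShift i f ∈ S.toSubmodule

/-- `S = θ H²(𝔻ⁿ)`, as an equality of sets of functions on the polydisc. -/
def EqMulHardy {n : ℕ} (S : ClosedSubmodule ℂ (Hardy n)) (θ : (Fin n → ℂ) → ℂ) : Prop :=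
  {u : polydisc n → ℂ | ∃ g ∈ S.toSubmodule, ∀ z, u z = g z} =
    {u : polydisc n → ℂ | ∃ f : Hardy n, ∀ z, u z = θ z * f z}

/-- `S` is a non-zero based doubly commuting subspace: a closed subspace of `H²(𝔻ⁿ)`, jointly
invariant under the shifts, whose restricted shifts `R_{z_i} = M_{z_i}|_S` doubly commute, and
which is of the form `θ H²(𝔻ⁿ)` for an inner function `θ` with `θ(0) ≠ 0`. -/
structure IsNonzeroBasedDoublyCommuting {n : ℕ} (S : ClosedSubmodule ℂ (Hardy n)) : Prop where
  invariant : IsShiftInvariant S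
  doublyCommuting : IsDoublyCommuting fun i => restrictOp (coordShift i) S (invariant i)
  eq_mul : ∃ θ : (Fin n → ℂ) → ℂ, IsInner θ ∧ θ 0 ≠ 0 ∧ EqMulHardy S θ

/-- Subspaces of the form `θ H²(𝔻ⁿ)` are invariant under all multiplication operators. -/
theorem IsNonzeroBasedDoublyCommuting.mulOp_mem {n : ℕ} {S : ClosedSubmodule ℂ (Hardy n)}
    (hS : IsNonzeroBasedDoublyCommuting S) (φ : (Fin n → ℂ) → ℂ) (hφ : IsMultiplier φ) :
    ∀ f ∈ S.toSubmodule, mulOp φ hφ f ∈ S.toSubmodule := by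
  obtain ⟨θ, -, -, hθ⟩ := hS.eq_mul
  intro f hf
  have h1 : (fun z => f z) ∈ {u : polydisc n → ℂ | ∃ g ∈ S.toSubmodule, ∀ z, u z = g z} :=
    ⟨f, hf, fun _ => rfl⟩
  rw [hθ] at h1
  obtain ⟨g, hg⟩ := h1
  have h2 : (fun z => mulOp φ hφ f z) ∈
      {u : polydisc n → ℂ | ∃ f : Hardy n, ∀ z, u z = θ z * f z} := by
    refine ⟨mulOp φ hφ g, fun z => ?_⟩
    simp only [mulOp_apply]
    rw [show f z = θ z * g z from hg z]
    ring
  rw [← hθ] at h2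
  obtain ⟨f', hf', hz⟩ := h2
  have : mulOp φ hφ f = f' := RKHS.ext hz
  rwa [this]

/-! Everything rests on the reproducing kernels. By `Hardy.adjoint_mulOp_szego`, the adjoint of
`M_φ` multiplies the kernel at `z` by `conj (φ z)`, so its powers tend to zero on that kernel once
`|φ z| < 1`. The kernels span a dense subspace and the powers are contractive, hence `|φ| < 1` on
the polydisc implies purity (`isPureContraction_mulOp`). Contractivity gives `|φ| ≤ 1`, and the
maximum modulus principle reduces the strict bound to the single inequality `|φ 0| < 1`.

If the restriction to `S = θ H²` is pure, project the kernel at the origin to `S`. The projection is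
an eigenvector of the adjoint of the restriction with eigenvalue `conj (φ 0)`; it is nonzero because
`θ` lies in `S` and `θ 0 ≠ 0`. Purity then forces `|φ 0| < 1`. Conversely, a pure `M_φ` is its own
restriction to `S = H²`, with `θ = 1`. -/

namespace Hardy

variable {n : ℕ}

/-! ### Coordinate shifts on coefficients. -/

/-- The coefficients of `z_i f` are the shifted coefficients of `f`. -/
theorem coeff_coordShift (i : Fin n) (f : Hardy n) :
    (coordShift i f).coeff =
      Function.extend (fun k : Fin n → ℕ => k + Pi.single i 1) f.coeff 0 := by
  have hs : Function.Injective fun k : Fin n → ℕ => k + Pi.single i 1 := add_left_injective _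
  rw [← sub_eq_zero]
  -- Both coefficient families sum to `z i * f z` on the polydisc, so uniqueness of power series
  -- applies to their difference.
  refine coeff_eq_zero_of_eval _ fun z hz => ?_
  have h1 := (hasSum_apply f ⟨z, hz⟩).mul_left (z i)
  rw [← hasSum_extend_zero hs] at h1
  have h2 := hasSum_apply (coordShift i f) ⟨z, hz⟩
  rw [coordShift, mulOp_apply] at h2
  have h3 := h2.sub h1
  rw [sub_self] at h3
  refine h3.congr_fun fun k => ?_
  rw [Pi.sub_apply, sub_mul]
  congr 1
  by_cases hk : ∃ j : Fin n → ℕ, j + Pi.single i 1 = k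
  · obtain ⟨j, rfl⟩ := hk
    have h4 : ∏ l, z l ^ (j + Pi.single i 1 : Fin n → ℕ) l = (∏ l, z l ^ j l) * z i := by
      simp only [Pi.add_apply, pow_add, Finset.prod_mul_distrib]
      congr 1
      rw [Finset.prod_eq_single i] <;> simp +contextual
    have e1 := hs.extend_apply f.coeff 0 j
    have e2 := hs.extend_apply (fun k => z i * (f.coeff k * ∏ l, z l ^ k l)) 0 j
    refine (congrArg₂ (· * ·) e1 h4).trans (Eq.trans ?_ e2.symm)
    ring
  · rw [Function.extend_apply' _ _ _ hk, Function.extend_apply' _ _ _ hk]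
    exact zero_mul _

theorem coeff_coordShift_add_single (i : Fin n) (f : Hardy n) (k : Fin n → ℕ) :
    (coordShift i f).coeff (k + Pi.single i 1) = f.coeff k := by
  rw [coeff_coordShift]
  exact (add_left_injective (Pi.single i 1 : Fin n → ℕ)).extend_apply f.coeff 0 k

theorem coeff_coordShift_of_eq_zero (i : Fin n) (f : Hardy n) {k : Fin n → ℕ} (hk : k i = 0) :
    (coordShift i f).coeff k = 0 := by
  rw [coeff_coordShift, Function.extend_apply']
  · rfl
  · rintro ⟨j, rfl⟩
    simp at hk

/-- The monomial `zᵏ`. -/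
noncomputable def monomial (k : Fin n → ℕ) : Hardy n :=
  ofCoeff (Pi.single k 1) <| memℓp_gen <| summable_of_ne_finset_zero (s := {k}) fun l hl => by
    rw [Pi.single_eq_of_ne (by simpa using hl)]
    simp

theorem inner_monomial (k : Fin n → ℕ) (f : Hardy n) : ⟪monomial k, f⟫_ℂ = f.coeff k := by
  refine (hasSum_inner (monomial k) f).unique ?_
  have h := hasSum_single (f := fun l => conj ((monomial k).coeff l) * f.coeff l) k
    fun l hl => by simp [monomial, coeff_ofCoeff, hl]
  simpa [monomial, coeff_ofCoeff] using h

theorem exists_add_single_eq {i : Fin n} {k : Fin n → ℕ} (hk : k i ≠ 0) :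
    ∃ l : Fin n → ℕ, l + Pi.single i 1 = k := by
  refine ⟨k - Pi.single i 1, tsub_add_cancel_of_le fun j => ?_⟩
  by_cases hj : j = i
  · subst hj
    simpa using Nat.one_le_iff_ne_zero.2 hk
  · simp [hj]

theorem coordShift_monomial (i : Fin n) (k : Fin n → ℕ) :
    coordShift i (monomial k) = monomial (k + Pi.single i 1) := by
  refine ext_coeff (funext fun l => ?_)
  by_cases hl : l i = 0
  · rw [coeff_coordShift_of_eq_zero i _ hl, monomial, coeff_ofCoeff, Pi.single_eq_of_ne]
    rintro rfl
    simp at hl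
  · obtain ⟨l, rfl⟩ := exists_add_single_eq hl
    rw [coeff_coordShift_add_single, monomial, monomial, coeff_ofCoeff, coeff_ofCoeff]
    simp [Pi.single_apply]

/-- The adjoint of a coordinate shift is the backward shift of the coefficients. -/
theorem coeff_adjoint_coordShift (i : Fin n) (f : Hardy n) (k : Fin n → ℕ) :
    (ContinuousLinearMap.adjoint (coordShift i) f).coeff k = f.coeff (k + Pi.single i 1) := by
  rw [← inner_monomial, ContinuousLinearMap.adjoint_inner_right, coordShift_monomial,
    inner_monomial]

theorem isDoublyCommuting_coordShift :
    IsDoublyCommuting (fun i => coordShift i : Fin n → Hardy n →L[ℂ] Hardy n) := by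
  refine ⟨fun i j => ?_, fun i j hij => ?_⟩
  · ext1 f
    refine RKHS.ext fun z => ?_
    simp only [mul_apply_eq_comp, coordShift, mulOp_apply]
    exact mul_left_comm _ _ _
  · ext1 f
    refine ext_coeff (funext fun k => ?_)
    simp only [mul_apply_eq_comp, coeff_adjoint_coordShift]
    -- Since `i ≠ j`, adding `e_i` leaves the exponent `k j` unchanged: if it is zero both sides
    -- vanish, and for `k = l + e_j` both equal the coefficient of `f` at `l + e_i`.
    by_cases hk : k j = 0
    · rw [coeff_coordShift_of_eq_zero j _ hk, coeff_coordShift_of_eq_zero]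
      simp [hk, hij.symm]
    · obtain ⟨l, rfl⟩ := exists_add_single_eq hk
      rw [coeff_coordShift_add_single, coeff_adjoint_coordShift, add_right_comm,
        coeff_coordShift_add_single]

/-! ### Szegő kernels as eigenvectors. -/

/-- The constant function `1`. -/
theorem monomial_zero_apply (z : polydisc n) : (monomial 0 : Hardy n) z = 1 := by
  rw [apply_eq_tsum, tsum_eq_single 0 fun k hk => by simp [monomial, coeff_ofCoeff, hk]]
  simp [monomial, coeff_ofCoeff]

theorem szego_ne_zero (z : polydisc n) : szego z ≠ 0 := by
  intro h
  have h1 := inner_szego z (monomial 0)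
  rw [h, inner_zero_left, monomial_zero_apply] at h1
  exact zero_ne_one h1

theorem adjoint_mulOp_szego {φ : (Fin n → ℂ) → ℂ} (hφ : IsMultiplier φ) (z : polydisc n) :
    ContinuousLinearMap.adjoint (mulOp φ hφ) (szego z) = conj (φ z) • szego z := by
  refine ext_inner_right ℂ fun f => ?_
  rw [ContinuousLinearMap.adjoint_inner_left, inner_szego, mulOp_apply, inner_smul_left,
    inner_szego, Complex.conj_conj]

/-- The Szegő kernel functions span a dense subspace. -/
theorem topologicalClosure_span_szego :
    (Submodule.span ℂ (Set.range (szego : polydisc n → Hardy n))).topologicalClosure = ⊤ := by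
  rw [Submodule.topologicalClosure_eq_top_iff, Submodule.eq_bot_iff]
  refine fun f hf => RKHS.ext fun z => ?_
  rw [← inner_szego, (Submodule.mem_orthogonal _ _).1 hf _ (Submodule.subset_span ⟨z, rfl⟩)]
  simp

end Hardy

/-! ### Purity, eigenvectors and restrictions on an abstract Hilbert space. -/

theorem pow_apply_of_eigenvector {H : Type*} [NormedAddCommGroup H]
    [InnerProductSpace ℂ H] {A : H →L[ℂ] H} {x : H} {c : ℂ} (hx : A x = c • x) (m : ℕ) :
    (A ^ m) x = c ^ m • x := by
  induction m with
  | zero => simp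
  | succ m ih => rw [pow_succ', mul_apply_eq_comp, ih, map_smul, hx, smul_smul, pow_succ]

section Operators

variable {H : Type*} [NormedAddCommGroup H] [InnerProductSpace ℂ H] [CompleteSpace H]

/-- The eigenvalues of the adjoint of a pure contraction lie in the open unit disc. -/
theorem IsPureContraction.norm_lt_one_of_adjoint_eigenvector {T : H →L[ℂ] H}
    (hT : IsPureContraction T) {x : H} (hx0 : x ≠ 0) {c : ℂ}
    (hx : ContinuousLinearMap.adjoint T x = c • x) : ‖c‖ < 1 := by
  by_contra! hc
  -- If `1 ≤ ‖c‖`, the norms `‖c‖ ^ m * ‖x‖` stay above `‖x‖ > 0` and cannot tend to zero.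
  refine (norm_pos_iff.2 hx0).not_ge (ge_of_tendsto' (hT.2 x) fun m => ?_)
  rw [pow_apply_of_eigenvector hx, norm_smul, norm_pow]
  exact le_mul_of_one_le_left (norm_nonneg _) (one_le_pow₀ hc)

/-- For a power bounded sequence, strong convergence to zero can be tested on a set with dense
linear span. -/
theorem isPureContraction_of_span_dense {T : H →L[ℂ] H} (hT : ‖T‖ ≤ 1) {s : Set H}
    (hs : (Submodule.span ℂ s).topologicalClosure = ⊤)
    (h : ∀ x ∈ s, Tendsto (fun m : ℕ => ‖(ContinuousLinearMap.adjoint T ^ m) x‖) atTop (𝓝 0)) :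
    IsPureContraction T := by
  refine ⟨hT, ?_⟩
  have hspan : ∀ x ∈ Submodule.span ℂ s,
      Tendsto (fun m : ℕ => (ContinuousLinearMap.adjoint T ^ m) x) atTop (𝓝 0) := by
    intro x hx
    induction hx using Submodule.span_induction with
    | mem x hx => exact tendsto_zero_iff_norm_tendsto_zero.2 (h x hx)
    | zero => simp
    | add x y _ _ ihx ihy => simpa using ihx.add ihy
    | smul c x _ ihx => simpa using ihx.const_smul c
  have hpow : ∀ m : ℕ, ‖ContinuousLinearMap.adjoint T ^ m‖ ≤ 1 := fun m => by
    -- The exponent zero is separate: the identity has norm at most one even on the trivial space,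
    -- where its norm is zero.
    rcases Nat.eq_zero_or_pos m with rfl | hm
    · rw [pow_zero]
      exact ContinuousLinearMap.norm_id_le
    · refine (norm_pow_le' _ hm).trans (pow_le_one₀ (norm_nonneg _) ?_)
      rwa [LinearIsometryEquiv.norm_map]
  intro x
  rw [Metric.tendsto_atTop]
  intro ε hε
  have hx : x ∈ closure (Submodule.span ℂ s : Set H) := by
    rw [← Submodule.topologicalClosure_coe, hs]
    trivial
  obtain ⟨y, hy, hxy⟩ := Metric.mem_closure_iff.1 hx (ε / 2) (half_pos hε)
  obtain ⟨N, hN⟩ := Metric.tendsto_atTop.1 (hspan y hy) (ε / 2) (half_pos hε)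
  refine ⟨N, fun m hm => ?_⟩
  have h1 := hN m hm
  rw [dist_zero_right] at h1 ⊢
  rw [norm_norm]
  have h2 : ‖(ContinuousLinearMap.adjoint T ^ m) (x - y)‖ ≤ ‖x - y‖ :=
    (ContinuousLinearMap.le_of_opNorm_le _ (hpow m) _).trans (one_mul _).le
  rw [dist_eq_norm] at hxy
  calc ‖(ContinuousLinearMap.adjoint T ^ m) x‖
      = ‖(ContinuousLinearMap.adjoint T ^ m) (x - y) + (ContinuousLinearMap.adjoint T ^ m) y‖ := by
        rw [← map_add, sub_add_cancel]
    _ ≤ _ := norm_add_le _ _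
    _ < ε := by linarith

/-- If `x` is an eigenvector of the adjoint of `T`, its projection to an invariant subspace is
mapped to the corresponding multiple by the adjoint of the restriction. -/
theorem adjoint_restrictOp_orthogonalProjection {T : H →L[ℂ] H} {S : ClosedSubmodule ℂ H}
    (hS : ∀ f ∈ S.toSubmodule, T f ∈ S.toSubmodule) {x : H} {c : ℂ}
    (hx : ContinuousLinearMap.adjoint T x = c • x) :
    ContinuousLinearMap.adjoint (restrictOp T S hS) (S.toSubmodule.orthogonalProjectionOnto x) =
      c • S.toSubmodule.orthogonalProjectionOnto x := by
  refine ext_inner_right ℂ fun f => ?_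
  -- For `f` in `S` the vector `T f` is again in `S`, so the projection can be dropped from both
  -- inner products, leaving the eigenvector equation for `x`.
  rw [ContinuousLinearMap.adjoint_inner_left, inner_smul_left,
    Submodule.inner_orthogonalProjectionOnto_eq_of_mem_right,
    Submodule.inner_orthogonalProjectionOnto_eq_of_mem_right, ← inner_smul_left, ← hx,
    ContinuousLinearMap.adjoint_inner_left]
  rfl

/-- The restriction to `⊤` acts on a subtype rather than on `H`; this intertwining carries purity
and double commutation across the inclusion. -/
theorem coe_adjoint_restrictOp_top (T : H →L[ℂ] H)
    (hT : ∀ f ∈ (⊤ : ClosedSubmodule ℂ H).toSubmodule, T f ∈ (⊤ : ClosedSubmodule ℂ H).toSubmodule)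
    (x : (⊤ : ClosedSubmodule ℂ H).toSubmodule) :
    (ContinuousLinearMap.adjoint (restrictOp T ⊤ hT) x : H) =
      ContinuousLinearMap.adjoint T (x : H) := by
  refine ext_inner_right ℂ fun f => ?_
  rw [ContinuousLinearMap.adjoint_inner_left]
  exact ContinuousLinearMap.adjoint_inner_left (restrictOp T ⊤ hT) ⟨f, trivial⟩ x

theorem IsPureContraction.restrictOp_top {T : H →L[ℂ] H} (h : IsPureContraction T)
    (hT : ∀ f ∈ (⊤ : ClosedSubmodule ℂ H).toSubmodule,
      T f ∈ (⊤ : ClosedSubmodule ℂ H).toSubmodule) :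
    IsPureContraction (restrictOp T ⊤ hT) := by
  refine ⟨ContinuousLinearMap.opNorm_le_bound _ zero_le_one fun x =>
    T.le_of_opNorm_le h.1 x, fun x => (h.2 x).congr fun m => ?_⟩
  refine (congrArg norm (?_ : _ = (((ContinuousLinearMap.adjoint (restrictOp T ⊤ hT) ^ m) x :
    (⊤ : ClosedSubmodule ℂ H).toSubmodule) : H)))
  induction m with
  | zero => simp
  | succ m ih =>
    rw [pow_succ', pow_succ', mul_apply_eq_comp, mul_apply_eq_comp, ih,
      coe_adjoint_restrictOp_top]

theorem IsDoublyCommuting.restrictOp_top {n : ℕ} {X : Fin n → H →L[ℂ] H} (h : IsDoublyCommuting X)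
    (hX : ∀ i, ∀ f ∈ (⊤ : ClosedSubmodule ℂ H).toSubmodule,
      X i f ∈ (⊤ : ClosedSubmodule ℂ H).toSubmodule) :
    IsDoublyCommuting fun i => restrictOp (X i) ⊤ (hX i) := by
  refine ⟨fun i j => ?_, fun i j hij => ?_⟩
  · ext1 x
    exact Subtype.ext (congrArg (fun A : H →L[ℂ] H => A x) (h.1 i j))
  · ext1 x
    refine Subtype.ext ?_
    rw [mul_apply_eq_comp, coe_adjoint_restrictOp_top]
    refine (congrArg (fun A : H →L[ℂ] H => A x) (h.2 i j hij)).trans ?_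
    exact congrArg (X j) (coe_adjoint_restrictOp_top (X i) (hX i) x).symm

end Operators

/-! ### The whole space as a witness. -/

/-- The whole Hardy space is a non-zero based doubly commuting subspace. -/
theorem isNonzeroBasedDoublyCommuting_top (n : ℕ) :
    IsNonzeroBasedDoublyCommuting (⊤ : ClosedSubmodule ℂ (Hardy n)) where
  invariant := fun _ _ _ => trivial
  doublyCommuting := Hardy.isDoublyCommuting_coordShift.restrictOp_top _
  eq_mul := by
    refine ⟨fun _ => 1, ⟨⟨differentiableOn_const _, 1, by simp⟩, ?_⟩, one_ne_zero, ?_⟩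
    · exact ae_of_all _ fun t => ⟨1, norm_one, tendsto_const_nhds⟩
    · ext u
      simp only [Set.mem_ofPred_eq, one_mul]
      exact ⟨fun ⟨g, _, hg⟩ => ⟨g, hg⟩, fun ⟨g, hg⟩ => ⟨g, trivial, hg⟩⟩

/-! ### Strict bounds on the symbol, and the equivalence. -/

/-- The norm on `Fin n → ℂ` is the sup norm. The ball form supplies the openness and connectedness
needed for the maximum modulus principle. -/
theorem polydisc_eq_ball (n : ℕ) : polydisc n = Metric.ball 0 1 := by
  ext z
  rw [mem_ball_zero_iff, pi_norm_lt_iff one_pos]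
  rfl

/-- By the maximum modulus principle, a holomorphic function on the polydisc bounded by one whose
value at the origin has modulus less than one takes all its values in the open unit disc. -/
theorem norm_lt_one_of_norm_zero_lt_one {n : ℕ} {φ : (Fin n → ℂ) → ℂ}
    (hφ : DifferentiableOn ℂ φ (polydisc n)) (hle : ∀ z ∈ polydisc n, ‖φ z‖ ≤ 1)
    (h0 : ‖φ 0‖ < 1) : ∀ z ∈ polydisc n, ‖φ z‖ < 1 := by
  intro z hz
  refine (hle z hz).lt_of_ne fun h1 => h0.ne ?_
  rw [polydisc_eq_ball] at hφ hle hz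
  -- A value of modulus one at `z` would be an interior maximum, making `‖φ‖` constantly one,
  -- against `h0`.
  have hmax : IsMaxOn (norm ∘ φ) (Metric.ball 0 1) z := fun w hw => by
    simpa [h1] using hle w hw
  have h2 := Complex.norm_eqOn_of_isPreconnected_of_isMaxOn (convex_ball _ _).isPreconnected
    Metric.isOpen_ball hφ hz hmax (Metric.mem_ball_self one_pos)
  exact (h2 : ‖φ 0‖ = ‖φ z‖).trans h1

/-- A contractive multiplier is bounded by one. -/
theorem norm_le_one_of_norm_mulOp_le_one {n : ℕ} {φ : (Fin n → ℂ) → ℂ} (hφ : IsMultiplier φ)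
    (h : ‖mulOp φ hφ‖ ≤ 1) : ∀ z ∈ polydisc n, ‖φ z‖ ≤ 1 := by
  intro z hz
  have h1 := ContinuousLinearMap.le_of_opNorm_le (ContinuousLinearMap.adjoint (mulOp φ hφ))
    ((LinearIsometryEquiv.norm_map _ _).trans_le h) (Hardy.szego ⟨z, hz⟩)
  rw [Hardy.adjoint_mulOp_szego, norm_smul, RCLike.norm_conj] at h1
  exact le_of_mul_le_mul_right h1 (norm_pos_iff.2 (Hardy.szego_ne_zero _))

/-- If all values of a contractive multiplier lie in the open unit disc, the multiplication
operator is a pure contraction. -/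
theorem isPureContraction_mulOp {n : ℕ} {φ : (Fin n → ℂ) → ℂ} (hφ : IsMultiplier φ)
    (h : ‖mulOp φ hφ‖ ≤ 1) (hlt : ∀ z ∈ polydisc n, ‖φ z‖ < 1) :
    IsPureContraction (mulOp φ hφ) := by
  refine isPureContraction_of_span_dense h Hardy.topologicalClosure_span_szego ?_
  rintro _ ⟨z, rfl⟩
  have h1 := (tendsto_pow_atTop_nhds_zero_of_lt_one (norm_nonneg _) (hlt z z.2)).mul_const
    ‖Hardy.szego z‖
  rw [zero_mul] at h1
  refine h1.congr fun m => ?_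
  rw [pow_apply_of_eigenvector (Hardy.adjoint_mulOp_szego hφ z), norm_smul, norm_pow,
    RCLike.norm_conj]

theorem zero_mem_polydisc (n : ℕ) : (0 : Fin n → ℂ) ∈ polydisc n := fun i => by simp

/-- Some function in a non-zero based subspace does not vanish at the origin. -/
theorem IsNonzeroBasedDoublyCommuting.orthogonalProjection_szego_ne_zero {n : ℕ}
    {S : ClosedSubmodule ℂ (Hardy n)} (hS : IsNonzeroBasedDoublyCommuting S) :
    S.toSubmodule.orthogonalProjectionOnto (Hardy.szego ⟨0, zero_mem_polydisc n⟩) ≠ 0 := by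
  obtain ⟨θ, -, hθ0, hθ⟩ := hS.eq_mul
  have h1 : (fun z : polydisc n => θ z) ∈
      {u : polydisc n → ℂ | ∃ f : Hardy n, ∀ z, u z = θ z * f z} :=
    ⟨Hardy.monomial 0, fun z => by rw [Hardy.monomial_zero_apply, mul_one]⟩
  rw [← hθ] at h1
  obtain ⟨g, hg, hgz⟩ := h1
  intro h
  -- Here `g` is `θ` as an element of `S`, and its inner product with the projected kernel is `g 0 =
  -- θ 0`.
  have h2 := Submodule.inner_orthogonalProjectionOnto_eq_of_mem_right (⟨g, hg⟩ : S.toSubmodule)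
    (Hardy.szego ⟨0, zero_mem_polydisc n⟩)
  rw [h, inner_zero_left, Hardy.inner_szego, ← hgz] at h2
  exact hθ0 h2.symm

theorem theorem3p10 (n : ℕ) (hn : 1 ≤ n) (φ : (Fin n → ℂ) → ℂ) (hφ : IsHInfty φ)
    (hmul : IsMultiplier φ) (hcontr : ‖mulOp φ hmul‖ ≤ 1) :
    IsPureContraction (mulOp φ hmul) ↔
      ∃ (S : ClosedSubmodule ℂ (Hardy n)) (hS : IsNonzeroBasedDoublyCommuting S),
        IsPureContraction (restrictOp (mulOp φ hmul) S (hS.mulOp_mem φ hmul)) := by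
  refine ⟨fun h => ⟨⊤, isNonzeroBasedDoublyCommuting_top n, h.restrictOp_top _⟩, ?_⟩
  rintro ⟨S, hS, h⟩
  -- The eigenvalue is `conj (φ 0)`, for the projection of the kernel at the origin.
  have h0 := h.norm_lt_one_of_adjoint_eigenvector hS.orthogonalProjection_szego_ne_zero
    (adjoint_restrictOp_orthogonalProjection _ (Hardy.adjoint_mulOp_szego hmul _))
  rw [RCLike.norm_conj] at h0
  exact isPureContraction_mulOp hmul hcontr
    (norm_lt_one_of_norm_zero_lt_one hφ.1 (norm_le_one_of_norm_mulOp_le_one hmul hcontr) h0)
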